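/- There are $m$ items, labelled by $[m]=\{1,\dots,m\}$, and two (possibly overlapping) groups $G_1,G_2\subseteq[m]$. For $\sigma\in\{0,1\}^2$ let $I_\sigma$ be the set of items $i$ such that, for each $\ell\in\{1,2\}$, $i\in G_\ell$ if and only if $\sigma_\ell=1$. The latent utilities $w=(w_1,\dots,w_m)$ are i.i.d. uniform on $[0,1]$. Given bias parameters $\beta_1,\beta_2\in(0,1]$, the observed utility of item $i$ is $\widehat w_i=\bigl(\prod_{\ell:\, i\in G_\ell}\beta_\ell\bigr)\,w_i$. A selection of $n$ items is a vector $x\in\{0,1\}^m$ with $\sum_i x_i=n$. For $L=(L_1,L_2)\in\mathbb Z_{\ge0}^2$ let $C(L)$ be the set of selections $x$ of $n$ items with $\sum_{i\in G_\ell}x_i\ge L_\ell$ for $\ell=1,2$. Let $x^\star\in\operatorname{argmax}_x\langle x,w\rangle$, over all selections of $n$ items, and, when $C(L)\neq\emptyset$, let $\widetilde x\in\operatorname{argmax}_{x\in C(L)}\langle x,\widehat w\rangle$ (with ties broken arbitrarily in both). The utility ratio is $$\mathcal R_{\mathcal U}(L,\beta)=\mathbb E_w\left[\frac{\langle\widetilde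 x,w\rangle}{\langle x^\star,w\rangle}\right].$$ **Theorem.** Let $\eta>0$, $\rho>0$ and $\beta_1,\beta_2\in(0,1]$. There is a threshold $m_0\in\mathbb N$, depending only on $\eta,\rho,\beta_1,\beta_2$, such that for all $m\ge m_0$, all $n$ with $\eta<\frac nm<1-\eta$, all groups $G_1,G_2\subseteq[m]$ with $\rho m\le|I_\sigma|\le(1-\rho)m$ for every $\sigma\in\{0,1\}^2$, and all lower bounds $L_1,L_2\in\mathbb Z_{\ge0}$ for which $C(L)\ne\emptyset$, the ratio $\langle\widetilde x,w\rangle/\langle x^\star,w\rangle$ is integrable and $$\mathcal R_{\mathcal U}(L,\beta)\;\le\;1-\Bigl(\frac{\rho}{3}\cdot\min\{\eta,1-\eta\}\cdot(1-\beta_1)(1-\beta_2)\Bigr)^2 .$$ -/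

import Mathlib

open MeasureTheory

noncomputable section

/-- Items are the elements of `Fin m`; `G ℓ` is the `ℓ`-th (possibly overlapping) group.
The intersection `I_σ` consists of the items that belong to `G ℓ` exactly for those `ℓ`
with `σ ℓ = true`. -/
def intersection {m p : ℕ} (G : Fin p → Finset (Fin m)) (σ : Fin p → Bool) : Finset (Fin m) :=
  Finset.univ.filter fun i => ∀ ℓ, i ∈ G ℓ ↔ σ ℓ = true

/-- Multiplicative implicit bias: the observed utility of item `i` is its latent utility `w i`
multiplied by `β ℓ` for every group `ℓ` that contains `i`. -/
def observedUtility {m p : ℕ} (G : Fin p → Finset (Fin m)) (β : Fin p → ℝ)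
    (w : Fin m → ℝ) (i : Fin m) : ℝ :=
  (∏ ℓ ∈ Finset.univ.filter (fun ℓ => i ∈ G ℓ), β ℓ) * w i

/-- The selections of exactly `n` of the `m` items. -/
def selections (m n : ℕ) : Set (Finset (Fin m)) :=
  {S | S.card = n}

/-- The selections of `n` items that satisfy the non-intersectional (group-wise) lower bounds:
at least `L ℓ` selected items lie in the group `G ℓ`. -/
def constrainedSelections {m p : ℕ} (n : ℕ) (G : Fin p → Finset (Fin m)) (L : Fin p → ℕ) :
    Set (Finset (Fin m)) :=
  {S | S ∈ selections m n ∧ ∀ ℓ, L ℓ ≤ (S ∩ G ℓ).card}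

/-- The utility of a selection `S` with respect to the item utilities `u`. -/
def utility {m : ℕ} (S : Finset (Fin m)) (u : Fin m → ℝ) : ℝ :=
  ∑ i ∈ S, u i

/-- `S` is one of the selections in `C` with the largest utility with respect to `u`. -/
def IsArgmax {m : ℕ} (C : Set (Finset (Fin m))) (u : Fin m → ℝ) (S : Finset (Fin m)) : Prop :=
  S ∈ C ∧ ∀ T ∈ C, utility T u ≤ utility S u

/-- The law of the latent utilities: i.i.d. uniform on `[0, 1]`. -/
def latentLaw (m : ℕ) : Measure (Fin m → ℝ) :=
  Measure.pi fun _ => volume.restrict (Set.Icc (0 : ℝ) 1)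

/-- `xs` is the latent-optimal selection `x⋆`, as a function of the latent utilities
`w ∈ [0, 1]^m` (with an arbitrary rule for breaking ties). -/
def IsLatentOptimal {m : ℕ} (n : ℕ) (xs : (Fin m → ℝ) → Finset (Fin m)) : Prop :=
  ∀ w : Fin m → ℝ, (∀ i, w i ∈ Set.Icc (0 : ℝ) 1) → IsArgmax (selections m n) w (xs w)

/-- `xt` is the selection `x̃` of the constrained decision maker, as a function of the latent
utilities `w ∈ [0, 1]^m`: it maximizes the observed utility subject to the lower bounds
(with an arbitrary rule for breaking ties). -/
def IsConstrainedOptimal {m p : ℕ} (n : ℕ) (G : Fin p → Finset (Fin m)) (β : Fin p → ℝ)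
    (L : Fin p → ℕ) (xt : (Fin m → ℝ) → Finset (Fin m)) : Prop :=
  ∀ w : Fin m → ℝ, (∀ i, w i ∈ Set.Icc (0 : ℝ) 1) →
    IsArgmax (constrainedSelections n G L) (observedUtility G β w) (xt w)

/-- The ratio of the latent utilities of the selections `xt w` and `xs w`. -/
def ratio {m : ℕ} (xt xs : (Fin m → ℝ) → Finset (Fin m)) (w : Fin m → ℝ) : ℝ :=
  utility (xt w) w / utility (xs w) w

/-- The utility ratio: the expectation of `⟨x̃, w⟩ / ⟨x⋆, w⟩` over the latent utilities. -/
def utilityRatio {m : ℕ} (xt xs : (Fin m → ℝ) → Finset (Fin m)) : ℝ :=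
  ∫ w, ratio xt xs w ∂(latentLaw m)

end

/-!
The constraints bound the number of selected items in each *group*, so they cannot control the
four *intersections* separately; if both groups are biased, this forces a loss linear in `m`.

Put `t = 1 - n / m`. The latent optimum selects roughly the items with utility above `t`. Suppose
the constrained selection also came close to this. Then it would contain items `i`, `j` of the
two single-group intersections with utility slightly above `t`, and would miss an item `i'`
outside both groups and an item `j'` inside both groups with utility slightly below `t`. Trading
`i`, `j` for `i'`, `j'` keeps the number of selected items in both groups, and changes the observed
utility by about `t * (1 + β₁ * β₂ - β₁ - β₂) = t * (1 - β₁) * (1 - β₂) > 0`, contradicting optimality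
(`exchange_le_of_isArgmax`). With bands of width `δ = η * (1 - β₁) * (1 - β₂) / 4` around `t`, it
follows that in one of the four intersections *all* items of the band are decided wrongly
(`exists_band_le_sum_itemLoss`).

The latent utility lost relative to the optimum is the sum of the distances to `t` of the wrongly
decided items, up to the deviation of the number of items above `t` from `n`
(`sum_itemLoss_le_sub`). A band over an intersection with at least `ρ * m` items costs
`ρ * m * δ² / 2` on average, and each of the five sums involved deviates from its mean by at most
`√m` in mean (`integral_abs_deviation_le`). Dividing by `⟨x⋆, w⟩ ≤ n ≤ m` shows that the utility
ratio is at most `1 - ρ δ² / 2 + O(1 / √m)`, which suffices because `ρ ≤ 1 / 4`.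

Integrability holds for every way of breaking ties because ties between different selections occur
only on finitely many hyperplanes (`ae_utility_ne`, `aemeasurable_utility_selector`).
-/

/-! ### Exchanging items across the four intersections -/

/-- Replacing two selected items `i`, `j` by two unselected items `i'`, `j'`. -/
def exchange {m : ℕ} (S : Finset (Fin m)) (i j i' j' : Fin m) : Finset (Fin m) :=
  insert i' (insert j' ((S.erase i).erase j))

lemma sum_exchange {m : ℕ} {S : Finset (Fin m)} {i j i' j' : Fin m} (hi : i ∈ S) (hj : j ∈ S)
    (hij : i ≠ j) (hi' : i' ∉ S) (hj' : j' ∉ S) (hij' : i' ≠ j') (f : Fin m → ℝ) :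
    ∑ k ∈ exchange S i j i' j', f k = ∑ k ∈ S, f k - f i - f j + f i' + f j' := by
  have h1 : j ∈ S.erase i := Finset.mem_erase.2 ⟨hij.symm, hj⟩
  rw [exchange, Finset.sum_insert (by simp [hij', hi']), Finset.sum_insert (by simp [hj']),
    ← Finset.add_sum_erase S f hi, ← Finset.add_sum_erase _ f h1]
  ring

lemma card_inter_eq_sum {m : ℕ} (S A : Finset (Fin m)) :
    ((S ∩ A).card : ℝ) = ∑ k ∈ S, if k ∈ A then (1 : ℝ) else 0 := by
  simp

lemma observedUtility_two {m : ℕ} (G : Fin 2 → Finset (Fin m)) (β : Fin 2 → ℝ)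
    (w : Fin m → ℝ) (i : Fin m) :
    observedUtility G β w i =
      (if i ∈ G 0 then β 0 else 1) * (if i ∈ G 1 then β 1 else 1) * w i := by
  simp [observedUtility, Finset.prod_filter, Fin.prod_univ_two]

/-- Trading one item of each single-group intersection for one item outside both groups and one
item inside both keeps the number of selected items in either group, so it cannot improve an
optimal constrained selection. -/
lemma exchange_le_of_isArgmax {m n : ℕ} {G : Fin 2 → Finset (Fin m)} {β : Fin 2 → ℝ}
    {L : Fin 2 → ℕ} {w : Fin m → ℝ} {S : Finset (Fin m)}
    (hS : IsArgmax (constrainedSelections n G L) (observedUtility G β w) S)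
    {i j i' j' : Fin m} (hi0 : i ∈ G 0) (hi1 : i ∉ G 1) (hj0 : j ∉ G 0) (hj1 : j ∈ G 1)
    (hi'0 : i' ∉ G 0) (hi'1 : i' ∉ G 1) (hj'0 : j' ∈ G 0) (hj'1 : j' ∈ G 1)
    (hi : i ∈ S) (hj : j ∈ S) (hi' : i' ∉ S) (hj' : j' ∉ S) :
    w i' + β 0 * β 1 * w j' ≤ β 0 * w i + β 1 * w j := by
  have hij : i ≠ j := fun h => hj0 (h ▸ hi0)
  have hij' : i' ≠ j' := fun h => hi'0 (h ▸ hj'0)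
  have hsum := sum_exchange hi hj hij hi' hj' hij'
  obtain ⟨⟨hcard, hL⟩, hmax⟩ := hS
  have hmem : exchange S i j i' j' ∈ constrainedSelections n G L := by
    refine ⟨?_, fun ℓ => ?_⟩
    · have := hsum fun _ => 1
      simp only [Finset.sum_const, nsmul_eq_mul, mul_one] at this
      have h2 : ((exchange S i j i' j').card : ℝ) = S.card := by linarith
      exact (Nat.cast_injective h2).trans hcard
    · have h := hsum fun k => if k ∈ G ℓ then 1 else 0
      rw [← card_inter_eq_sum, ← card_inter_eq_sum] at h
      have h2 : ((exchange S i j i' j' ∩ G ℓ).card : ℝ) = (S ∩ G ℓ).card := by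
        rw [h]
        fin_cases ℓ <;> simp [*]
      exact (Nat.cast_injective h2) ▸ hL ℓ
  have h := hmax _ hmem
  rw [utility, utility, hsum] at h
  simp only [observedUtility_two, if_pos, if_neg, hi0, hi1, hj0, hj1, hi'0, hi'1, hj'0, hj'1,
    not_false_eq_true] at h
  linarith

/-! ### The loss of a selection relative to a threshold -/

/-- Relative to the threshold `t`, the selection `S` loses `w i - t` for each unselected item
above `t` and `t - w i` for each selected item below `t`. -/
def itemLoss {m : ℕ} (S : Finset (Fin m)) (t : ℝ) (w : Fin m → ℝ) (i : Fin m) : ℝ :=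
  max (w i - t) 0 - if i ∈ S then w i - t else 0

lemma itemLoss_nonneg {m : ℕ} (S : Finset (Fin m)) (t : ℝ) (w : Fin m → ℝ) (i : Fin m) :
    0 ≤ itemLoss S t w i := by
  unfold itemLoss
  split_ifs
  · linarith [le_max_left (w i - t) 0]
  · linarith [le_max_right (w i - t) 0]

lemma utility_eq_sub_itemLoss {m : ℕ} (S : Finset (Fin m)) (t : ℝ) (w : Fin m → ℝ) :
    utility S w = S.card * t + ∑ i, max (w i - t) 0 - ∑ i, itemLoss S t w i := by
  have : ∑ i, (if i ∈ S then w i - t else 0) = utility S w - S.card * t := by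
    simp [utility, Finset.sum_sub_distrib]
  simp only [itemLoss, Finset.sum_sub_distrib, this]
  ring

/-- The indicator function of being above the threshold `t`. -/
noncomputable def aboveInd (t : ℝ) : ℝ → ℝ := (Set.Ioi t).indicator 1

/-- The excess over `t` of a value in `(t, t + δ)`; zero elsewhere. -/
noncomputable def upperBand (t δ : ℝ) : ℝ → ℝ := (Set.Ioo t (t + δ)).indicator fun x => x - t

/-- The shortfall below `t` of a value in `(t - δ, t)`; zero elsewhere. -/
noncomputable def lowerBand (t δ : ℝ) : ℝ → ℝ := (Set.Ioo (t - δ) t).indicator fun x => t - x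

/-- Filling up or cutting down the set of items above `t` to exactly `n` items costs at most one
per item added or removed. -/
lemma exists_card_eq_le_utility {m n : ℕ} (hn : n ≤ m) {w : Fin m → ℝ}
    (hw : ∀ i, w i ∈ Set.Icc (0 : ℝ) 1) {t : ℝ} (ht : t ∈ Set.Icc (0 : ℝ) 1) :
    ∃ T : Finset (Fin m), T.card = n ∧
      n * t + ∑ i, max (w i - t) 0 - |∑ i, aboveInd t (w i) - n| ≤ utility T w := by
  classical
  set P : Finset (Fin m) := Finset.univ.filter fun i => t < w i with hP
  have hN : ∑ i, aboveInd t (w i) = P.card := by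
    simp [aboveInd, Set.indicator_apply, hP]
  -- Each item of the symmetric difference with `P` has a loss of at most one.
  have key : ∀ T : Finset (Fin m), T.card = n →
      (∑ i, itemLoss T t w i ≤ |(P.card : ℝ) - n|) →
      n * t + ∑ i, max (w i - t) 0 - |∑ i, aboveInd t (w i) - n| ≤ utility T w := by
    intro T hT h
    rw [utility_eq_sub_itemLoss T t w, hN, hT]
    linarith
  have loss_le : ∀ (T D : Finset (Fin m)), (∀ i, i ∉ D → (i ∈ T ↔ i ∈ P)) →
      ∑ i, itemLoss T t w i ≤ D.card := by
    intro T D hD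
    have : ∀ i, itemLoss T t w i ≤ if i ∈ D then 1 else 0 := by
      intro i
      have h1 := (hw i).1
      have h2 := (hw i).2
      have h3 := ht.1
      have h4 := ht.2
      by_cases hi : i ∈ D
      · rw [if_pos hi, itemLoss]
        rcases max_cases (w i - t) 0 with h | h <;> split_ifs <;> linarith
      · rw [if_neg hi, itemLoss]
        have h5 : i ∈ T ↔ t < w i := by rw [hD i hi, hP]; simp
        rcases max_cases (w i - t) 0 with h | h <;> split_ifs with h6 <;> rw [h5] at h6 <;>
          linarith
    exact (Finset.sum_le_sum fun i _ => this i).trans (by simp)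
  rcases le_total n P.card with h | h
  · obtain ⟨T, hTP, hT⟩ := Finset.exists_subset_card_eq h
    refine ⟨T, hT, key T hT ((loss_le T (P \ T) ?_).trans ?_)⟩
    · intro i hi
      have := @hTP i
      simp only [Finset.mem_sdiff] at hi
      tauto
    · rw [Finset.card_sdiff_of_subset hTP, hT, Nat.cast_sub h]
      exact le_abs_self _
  · obtain ⟨T, hPT, -, hT⟩ := Finset.exists_subsuperset_card_eq (Finset.subset_univ P) h
      (by simpa using hn)
    refine ⟨T, hT, key T hT ((loss_le T (T \ P) ?_).trans ?_)⟩
    · intro i hi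
      have := @hPT i
      simp only [Finset.mem_sdiff] at hi
      tauto
    · rw [Finset.card_sdiff_of_subset hPT, hT, Nat.cast_sub h, abs_sub_comm]
      exact le_abs_self _

/-- The gap to the latent optimum is at least the total item loss, up to the deviation of the
number of items above the threshold from `n`. -/
lemma sum_itemLoss_le_sub {m n : ℕ} {w : Fin m → ℝ}
    (hw : ∀ i, w i ∈ Set.Icc (0 : ℝ) 1) {t : ℝ} (ht : t ∈ Set.Icc (0 : ℝ) 1)
    {S T : Finset (Fin m)} (hT : IsArgmax (selections m n) w T) (hS : S.card = n) :
    ∑ i, itemLoss S t w i - |∑ i, aboveInd t (w i) - n| ≤ utility T w - utility S w := by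
  have hn : n ≤ m := by simpa [hS] using Finset.card_le_univ S
  obtain ⟨T', hT', h⟩ := exists_card_eq_le_utility hn hw ht
  have := hT.2 T' hT'
  rw [utility_eq_sub_itemLoss S t w, hS]
  linarith

lemma sum_upperBand_le_sum_itemLoss {m : ℕ} {S I : Finset (Fin m)} {t δ : ℝ} {w : Fin m → ℝ}
    (h : ∀ i ∈ I, w i ∈ Set.Ioo t (t + δ) → i ∉ S) :
    ∑ i ∈ I, upperBand t δ (w i) ≤ ∑ i, itemLoss S t w i := by
  refine (Finset.sum_le_sum fun i hi => ?_).trans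
    (Finset.sum_le_univ_sum_of_nonneg (itemLoss_nonneg S t w))
  by_cases hw : w i ∈ Set.Ioo t (t + δ)
  · simp [upperBand, hw, itemLoss, h i hi hw]
  · simpa [upperBand, hw] using itemLoss_nonneg S t w i

lemma sum_lowerBand_le_sum_itemLoss {m : ℕ} {S I : Finset (Fin m)} {t δ : ℝ} {w : Fin m → ℝ}
    (h : ∀ i ∈ I, w i ∈ Set.Ioo (t - δ) t → i ∈ S) :
    ∑ i ∈ I, lowerBand t δ (w i) ≤ ∑ i, itemLoss S t w i := by
  refine (Finset.sum_le_sum fun i hi => ?_).trans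
    (Finset.sum_le_univ_sum_of_nonneg (itemLoss_nonneg S t w))
  by_cases hw : w i ∈ Set.Ioo (t - δ) t
  · simp [lowerBand, hw, itemLoss, h i hi hw, max_eq_right (sub_nonpos.2 hw.2.le)]
  · simpa [lowerBand, hw] using itemLoss_nonneg S t w i

lemma mem_intersection_two {m : ℕ} (G : Fin 2 → Finset (Fin m)) (a b : Bool) (i : Fin m) :
    i ∈ intersection G ![a, b] ↔ (i ∈ G 0 ↔ a = true) ∧ (i ∈ G 1 ↔ b = true) := by
  simp [intersection, Fin.forall_fin_two]

/-- The total item loss of an optimal constrained selection is at least the band sum of one of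
the four intersections: otherwise the selection would contain items with utility just above `t`
from the single-group intersections, while missing items with utility just below `t` from the
other two, and exchanging them would be an improvement as `β 0 + β 1 < 1 + β 0 * β 1`. -/
lemma exists_band_le_sum_itemLoss {m n : ℕ} {G : Fin 2 → Finset (Fin m)} {β : Fin 2 → ℝ}
    (hβ : ∀ ℓ, 0 < β ℓ) {L : Fin 2 → ℕ} {w : Fin m → ℝ} {S : Finset (Fin m)}
    (hS : IsArgmax (constrainedSelections n G L) (observedUtility G β w) S) {t δ : ℝ}
    (hδ : δ * ((1 + β 0) * (1 + β 1)) ≤ t * ((1 - β 0) * (1 - β 1))) :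
    ∑ i ∈ intersection G ![true, false], upperBand t δ (w i) ≤ ∑ i, itemLoss S t w i ∨
    ∑ i ∈ intersection G ![false, true], upperBand t δ (w i) ≤ ∑ i, itemLoss S t w i ∨
    ∑ i ∈ intersection G ![false, false], lowerBand t δ (w i) ≤ ∑ i, itemLoss S t w i ∨
    ∑ i ∈ intersection G ![true, true], lowerBand t δ (w i) ≤ ∑ i, itemLoss S t w i := by
  by_contra! hcon
  obtain ⟨h10, h01, h00, h11⟩ := hcon
  have hup : ∀ I : Finset (Fin m),
      ∑ i, itemLoss S t w i < ∑ i ∈ I, upperBand t δ (w i) →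
      ∃ i ∈ I, w i ∈ Set.Ioo t (t + δ) ∧ i ∈ S := by
    intro I hI
    by_contra! h
    exact absurd (sum_upperBand_le_sum_itemLoss h) hI.not_ge
  have hlow : ∀ I : Finset (Fin m),
      ∑ i, itemLoss S t w i < ∑ i ∈ I, lowerBand t δ (w i) →
      ∃ i ∈ I, w i ∈ Set.Ioo (t - δ) t ∧ i ∉ S := by
    intro I hI
    by_contra! h
    exact absurd (sum_lowerBand_le_sum_itemLoss h) hI.not_ge
  obtain ⟨i, hi, hiw, hiS⟩ := hup _ h10
  obtain ⟨j, hj, hjw, hjS⟩ := hup _ h01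
  obtain ⟨i', hi', hi'w, hi'S⟩ := hlow _ h00
  obtain ⟨j', hj', hj'w, hj'S⟩ := hlow _ h11
  rw [mem_intersection_two] at hi hj hi' hj'
  simp only [iff_true, Bool.false_eq_true, iff_false] at hi hj hi' hj'
  have h := exchange_le_of_isArgmax hS hi.1 hi.2 hj.1 hj.2 hi'.1 hi'.2 hj'.1 hj'.2 hiS hjS
    hi'S hj'S
  have e1 := mul_lt_mul_of_pos_left hiw.2 (hβ 0)
  have e2 := mul_lt_mul_of_pos_left hjw.2 (hβ 1)
  have e3 := mul_lt_mul_of_pos_left hj'w.1 (mul_pos (hβ 0) (hβ 1))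
  linarith [hi'w.1]

/-! ### The law of the latent utilities -/

instance isProbabilityMeasure_unitInterval :
    IsProbabilityMeasure (volume.restrict (Set.Icc (0 : ℝ) 1)) :=
  ⟨by simp⟩

instance isProbabilityMeasure_latentLaw (m : ℕ) : IsProbabilityMeasure (latentLaw m) := by
  unfold latentLaw; infer_instance

lemma latentLaw_eq_restrict (m : ℕ) :
    latentLaw m = volume.restrict (Set.univ.pi fun _ : Fin m => Set.Icc (0 : ℝ) 1) := by
  rw [latentLaw, volume_pi, Measure.restrict_pi_pi]

lemma ae_mem_Icc_latentLaw (m : ℕ) : ∀ᵐ w ∂latentLaw m, ∀ i, w i ∈ Set.Icc (0 : ℝ) 1 := by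
  rw [latentLaw_eq_restrict]
  filter_upwards [ae_restrict_mem (MeasurableSet.univ_pi fun _ => measurableSet_Icc)] with w hw i
  exact hw i trivial

/-! ### Measurability of the utility of a selection rule -/

/-- Two different selections have the same utility only on a hyperplane, hence almost never. -/
lemma ae_utility_ne {m : ℕ} {c : Fin m → ℝ} (hc : ∀ i, 0 < c i) {S T : Finset (Fin m)}
    (hST : S ≠ T) :
    ∀ᵐ w ∂latentLaw m, utility S (fun i => c i * w i) ≠ utility T (fun i => c i * w i) := by
  let φ : (Fin m → ℝ) →ₗ[ℝ] ℝ :=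
    ∑ i ∈ S, c i • LinearMap.proj i - ∑ i ∈ T, c i • LinearMap.proj i
  have hφ : ∀ w, φ w = utility S (fun i => c i * w i) - utility T (fun i => c i * w i) := by
    intro w
    simp [φ, utility]
  have hker : LinearMap.ker φ ≠ ⊤ := by
    intro h
    rw [LinearMap.ker_eq_top] at h
    refine hST (Finset.ext fun i => ?_)
    have h1 := hφ (Pi.single i 1)
    rw [h] at h1
    simp only [LinearMap.zero_apply, utility, Pi.single_apply, mul_ite, mul_one, mul_zero,
      Finset.sum_ite_eq'] at h1
    have := hc i
    split_ifs at h1 with h2 h3 h3 <;> first | tauto | linarith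
  have h0 := Measure.addHaar_submodule (volume : Measure (Fin m → ℝ)) _ hker
  rw [latentLaw_eq_restrict]
  refine ae_restrict_of_ae ?_
  rw [ae_iff]
  convert h0 using 2
  ext w
  simp [hφ, sub_eq_zero]

lemma measurable_utility_mul {m : ℕ} (c : Fin m → ℝ) (S : Finset (Fin m)) :
    Measurable fun w : Fin m → ℝ => utility S fun i => c i * w i := by
  unfold utility
  fun_prop

lemma measurableSet_isArgmax {m : ℕ} (c : Fin m → ℝ) (C : Set (Finset (Fin m)))
    (S : Finset (Fin m)) :
    MeasurableSet {w : Fin m → ℝ | IsArgmax C (fun i => c i * w i) S} := by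
  simp only [IsArgmax, Set.ofPred_and, Set.ofPred_forall]
  exact (MeasurableSet.const _).inter (MeasurableSet.iInter fun T => MeasurableSet.iInter fun _ =>
    measurableSet_le (measurable_utility_mul c T) (measurable_utility_mul c S))

/-- However ties are broken, the latent utility of the selected set is almost everywhere
measurable, because the optimal set is almost surely unique. -/
lemma aemeasurable_utility_selector {m : ℕ} {c : Fin m → ℝ} (hc : ∀ i, 0 < c i)
    {C : Set (Finset (Fin m))} {x : (Fin m → ℝ) → Finset (Fin m)}
    (hx : ∀ w : Fin m → ℝ, (∀ i, w i ∈ Set.Icc (0 : ℝ) 1) →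
      IsArgmax C (fun i => c i * w i) (x w)) :
    AEMeasurable (fun w => utility (x w) w) (latentLaw m) := by
  refine ⟨fun w => ∑ S : Finset (Fin m),
    {w : Fin m → ℝ | IsArgmax C (fun i => c i * w i) S}.indicator (utility S) w, ?_, ?_⟩
  · refine Finset.measurable_sum _ fun S _ => Measurable.indicator ?_ (measurableSet_isArgmax c C S)
    simpa using measurable_utility_mul 1 S
  · have hne : ∀ᵐ w ∂latentLaw m, ∀ S T : Finset (Fin m), S ≠ T →
        utility S (fun i => c i * w i) ≠ utility T (fun i => c i * w i) := by
      simp only [ae_all_iff]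
      exact fun S T hST => ae_utility_ne hc hST
    filter_upwards [ae_mem_Icc_latentLaw m, hne] with w hw hne
    rw [Finset.sum_eq_single (x w)]
    · rw [Set.indicator_of_mem]
      exact hx w hw
    · intro S _ hS
      refine Set.indicator_of_notMem (fun hmem => ?_) _
      exact hne S (x w) hS (le_antisymm ((hx w hw).2 S hmem.1) (hmem.2 _ (hx w hw).1))
    · simp

/-! ### Deviations of sums over items -/

/-- The deviation of the sum of `g (w i)` over the items `i ∈ I` from its expectation. -/
noncomputable def deviation {m : ℕ} (I : Finset (Fin m)) (g : ℝ → ℝ) (w : Fin m → ℝ) : ℝ :=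
  ∑ i ∈ I, g (w i) - I.card * ∫ x in Set.Icc (0 : ℝ) 1, g x

lemma memLp_comp_eval {m : ℕ} {g : ℝ → ℝ} (hg : Measurable g)
    (hg01 : ∀ x, g x ∈ Set.Icc (0 : ℝ) 1) (i : Fin m) :
    MemLp (fun w : Fin m → ℝ => g (w i)) 2 (latentLaw m) :=
  MemLp.of_bound (hg.comp (measurable_pi_apply i)).aestronglyMeasurable 1 (.of_forall fun w => by
    rw [Real.norm_eq_abs, abs_of_nonneg (hg01 _).1]; exact (hg01 _).2)

lemma memLp_deviation {m : ℕ} (I : Finset (Fin m)) {g : ℝ → ℝ} (hg : Measurable g)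
    (hg01 : ∀ x, g x ∈ Set.Icc (0 : ℝ) 1) : MemLp (deviation I g) 2 (latentLaw m) :=
  MemLp.sub (memLp_finsetSum _ fun i _ => memLp_comp_eval hg hg01 i) (memLp_const _)

lemma integral_deviation_sq_le {m : ℕ} (I : Finset (Fin m)) {g : ℝ → ℝ} (hg : Measurable g)
    (hg01 : ∀ x, g x ∈ Set.Icc (0 : ℝ) 1) :
    ∫ w, deviation I g w ^ 2 ∂latentLaw m ≤ m := by
  classical
  set X : Fin m → ℝ → ℝ := fun i => if i ∈ I then g else 0 with hX
  have hXm : ∀ i, Measurable (X i) := by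
    intro i
    simp only [hX]
    split_ifs
    exacts [hg, measurable_zero]
  have hX01 : ∀ i x, X i x ∈ Set.Icc (0 : ℝ) 1 := by
    intro i x
    simp only [hX]
    split_ifs
    exacts [hg01 x, by simp]
  have hmem : ∀ i, MemLp (X i) 2 (volume.restrict (Set.Icc (0 : ℝ) 1)) := fun i =>
    MemLp.of_bound (hXm i).aestronglyMeasurable 1 (.of_forall fun x => by
      rw [Real.norm_eq_abs, abs_of_nonneg (hX01 i x).1]; exact (hX01 i x).2)
  have hsum : (∑ i, fun w : Fin m → ℝ => X i (w i)) = fun w => ∑ i ∈ I, g (w i) := by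
    ext w
    simp only [Finset.sum_apply, hX, ite_apply, Pi.zero_apply, Finset.sum_ite_mem,
      Finset.univ_inter]
  have hmean : ∫ w, ∑ i ∈ I, g (w i) ∂latentLaw m =
      I.card * ∫ x in Set.Icc (0 : ℝ) 1, g x := by
    rw [integral_finsetSum _ fun i _ => (memLp_comp_eval hg hg01 i).integrable one_le_two]
    simp_rw [latentLaw, integral_comp_eval (X := fun _ => ℝ)
      (μ := fun _ : Fin m => volume.restrict (Set.Icc (0 : ℝ) 1)) hg.aestronglyMeasurable]
    simp
  have hvar := ProbabilityTheory.variance_sum_pi hmem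
  rw [hsum, ProbabilityTheory.variance_eq_integral
    (Measurable.aemeasurable (by fun_prop))] at hvar
  change ∫ w, (_ - ∫ w, ∑ i ∈ I, g (w i) ∂latentLaw m) ^ 2 ∂latentLaw m = _ at hvar
  rw [hmean] at hvar
  refine hvar.trans_le ((Finset.sum_le_sum fun i _ =>
    (ProbabilityTheory.variance_le_sq_of_bounded (.of_forall (hX01 i)) (hXm i).aemeasurable).trans
      (show ((1 - 0 : ℝ) / 2) ^ 2 ≤ 1 by norm_num)).trans ?_)
  simp

/-- The mean absolute deviation of a sum of at most `m` independent `[0, 1]`-valued terms is at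
most `√m`. -/
lemma integral_abs_deviation_le {m : ℕ} (hm : 0 < m) (I : Finset (Fin m)) {g : ℝ → ℝ}
    (hg : Measurable g) (hg01 : ∀ x, g x ∈ Set.Icc (0 : ℝ) 1) :
    ∫ w, |deviation I g w| ∂latentLaw m ≤ √m := by
  have hL2 := memLp_deviation I hg hg01
  have hi := hL2.integrable_sq
  have hle := integral_deviation_sq_le I hg hg01
  have hm' : 0 < √(m : ℝ) := Real.sqrt_pos.2 (by exact_mod_cast hm)
  have hsq : √(m : ℝ) * √m = m := Real.mul_self_sqrt m.cast_nonneg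
  -- The inequality of arithmetic and geometric means bounds the mean by the second moment.
  calc ∫ w, |deviation I g w| ∂latentLaw m
      ≤ ∫ w, ((2 * √m)⁻¹ * deviation I g w ^ 2 + √m / 2) ∂latentLaw m := by
        refine integral_mono (hL2.integrable one_le_two).abs
          ((hi.const_mul _).add (integrable_const _)) fun w => ?_
        have h := sq_nonneg (|deviation I g w| - √m)
        simp only
        rw [← sq_abs (deviation I g w), inv_mul_eq_div,
          div_add_div _ _ (by positivity) (by norm_num), le_div_iff₀ (by positivity)]
        nlinarith
    _ = (2 * √m)⁻¹ * ∫ w, deviation I g w ^ 2 ∂latentLaw m + √m / 2 := by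
        rw [integral_add (hi.const_mul _) (integrable_const _), integral_const_mul]
        simp
    _ ≤ (2 * √m)⁻¹ * m + √m / 2 := by gcongr
    _ = √m := by
        nth_rewrite 2 [← hsq]
        field_simp
        ring

/-! ### The threshold indicator and the bands -/

lemma measurable_aboveInd (t : ℝ) : Measurable (aboveInd t) :=
  measurable_one.indicator measurableSet_Ioi

lemma measurable_upperBand (t δ : ℝ) : Measurable (upperBand t δ) :=
  (measurable_id.sub_const t).indicator measurableSet_Ioo

lemma measurable_lowerBand (t δ : ℝ) : Measurable (lowerBand t δ) :=
  (measurable_id.const_sub t).indicator measurableSet_Ioo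

lemma aboveInd_mem_Icc (t x : ℝ) : aboveInd t x ∈ Set.Icc (0 : ℝ) 1 := by
  by_cases h : x ∈ Set.Ioi t <;> simp [aboveInd, h]

lemma upperBand_mem_Icc {t δ : ℝ} (hδ : δ ≤ 1) (x : ℝ) : upperBand t δ x ∈ Set.Icc (0 : ℝ) 1 := by
  by_cases h : x ∈ Set.Ioo t (t + δ)
  · rw [upperBand, Set.indicator_of_mem h]
    exact ⟨by linarith [h.1], by linarith [h.2]⟩
  · simp [upperBand, h]

lemma lowerBand_mem_Icc {t δ : ℝ} (hδ : δ ≤ 1) (x : ℝ) : lowerBand t δ x ∈ Set.Icc (0 : ℝ) 1 := by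
  by_cases h : x ∈ Set.Ioo (t - δ) t
  · rw [lowerBand, Set.indicator_of_mem h]
    exact ⟨by linarith [h.2], by linarith [h.1]⟩
  · simp [lowerBand, h]

lemma integral_aboveInd {t : ℝ} (ht : t ∈ Set.Icc (0 : ℝ) 1) :
    ∫ x in Set.Icc (0 : ℝ) 1, aboveInd t x = 1 - t := by
  have h : Set.Icc (0 : ℝ) 1 ∩ Set.Ioi t = Set.Ioc t 1 := by
    ext x
    simp only [Set.mem_inter_iff, Set.mem_Icc, Set.mem_Ioi, Set.mem_Ioc]
    exact ⟨fun h => ⟨h.2, h.1.2⟩, fun h => ⟨⟨ht.1.trans h.1.le, h.2⟩, h.1⟩⟩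
  rw [aboveInd, setIntegral_indicator measurableSet_Ioi, h]
  simp [ht.2]

lemma integral_upperBand {t δ : ℝ} (ht : 0 ≤ t) (hδ : 0 ≤ δ) (htδ : t + δ ≤ 1) :
    ∫ x in Set.Icc (0 : ℝ) 1, upperBand t δ x = δ ^ 2 / 2 := by
  have h : Set.Icc (0 : ℝ) 1 ∩ Set.Ioo t (t + δ) = Set.Ioo t (t + δ) :=
    Set.inter_eq_right.2 fun x hx => ⟨ht.trans hx.1.le, hx.2.le.trans htδ⟩
  rw [upperBand, setIntegral_indicator measurableSet_Ioo, h, ← integral_Ioc_eq_integral_Ioo,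
    ← intervalIntegral.integral_of_le (by linarith)]
  simp [intervalIntegral.integral_comp_sub_right fun x : ℝ => x]

lemma integral_lowerBand {t δ : ℝ} (ht : t ≤ 1) (hδ : 0 ≤ δ) (htδ : δ ≤ t) :
    ∫ x in Set.Icc (0 : ℝ) 1, lowerBand t δ x = δ ^ 2 / 2 := by
  have h : Set.Icc (0 : ℝ) 1 ∩ Set.Ioo (t - δ) t = Set.Ioo (t - δ) t :=
    Set.inter_eq_right.2 fun x hx => ⟨by linarith [hx.1], hx.2.le.trans ht⟩
  rw [lowerBand, setIntegral_indicator measurableSet_Ioo, h, ← integral_Ioc_eq_integral_Ioo,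
    ← intervalIntegral.integral_of_le (by linarith)]
  simp [intervalIntegral.integral_comp_sub_left fun x : ℝ => x]

/-! ### The bound on the utility ratio -/

lemma sum_card_intersection {m p : ℕ} (G : Fin p → Finset (Fin m)) :
    ∑ σ : Fin p → Bool, (intersection G σ).card = m := by
  classical
  have h := Finset.card_eq_sum_card_fiberwise (s := (Finset.univ : Finset (Fin m)))
    (t := Finset.univ) (f := fun i (ℓ : Fin p) => decide (i ∈ G ℓ))
    fun _ _ => Finset.mem_coe.2 (Finset.mem_univ _)
  rw [Finset.card_univ, Fintype.card_fin] at h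
  refine Eq.trans ?_ h.symm
  refine Finset.sum_congr rfl fun σ _ => congrArg Finset.card (Finset.ext fun i => ?_)
  simp only [intersection, Finset.mem_filter, Finset.mem_univ, true_and, funext_iff]
  refine forall_congr' fun ℓ => ?_
  cases σ ℓ <;> simp

/-- The deviations from the mean that control the random part of the utility loss: the number of
items above the threshold `t`, and the band sums of the four intersections. -/
noncomputable def totalDeviation {m : ℕ} (G : Fin 2 → Finset (Fin m)) (t δ : ℝ)
    (w : Fin m → ℝ) : ℝ :=
  |deviation Finset.univ (aboveInd t) w| +
    (|deviation (intersection G ![true, false]) (upperBand t δ) w| +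
     |deviation (intersection G ![false, true]) (upperBand t δ) w| +
     |deviation (intersection G ![false, false]) (lowerBand t δ) w| +
     |deviation (intersection G ![true, true]) (lowerBand t δ) w|)

lemma integral_totalDeviation_le {m : ℕ} (hm : 0 < m) (G : Fin 2 → Finset (Fin m)) (t : ℝ)
    {δ : ℝ} (hδ : δ ≤ 1) : Integrable (totalDeviation G t δ) (latentLaw m) ∧
      ∫ w, totalDeviation G t δ w ∂latentLaw m ≤ 5 * √m := by
  have ha := fun I : Finset (Fin m) =>
    ((memLp_deviation I (measurable_aboveInd t) (aboveInd_mem_Icc t)).integrable one_le_two).abs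
  have hu := fun I : Finset (Fin m) => ((memLp_deviation I (measurable_upperBand t δ)
    (upperBand_mem_Icc hδ)).integrable one_le_two).abs
  have hl := fun I : Finset (Fin m) => ((memLp_deviation I (measurable_lowerBand t δ)
    (lowerBand_mem_Icc hδ)).integrable one_le_two).abs
  have ha' := fun I : Finset (Fin m) =>
    integral_abs_deviation_le hm I (measurable_aboveInd t) (aboveInd_mem_Icc t)
  have hu' := fun I : Finset (Fin m) =>
    integral_abs_deviation_le hm I (measurable_upperBand t δ) (upperBand_mem_Icc hδ)
  have hl' := fun I : Finset (Fin m) =>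
    integral_abs_deviation_le hm I (measurable_lowerBand t δ) (lowerBand_mem_Icc hδ)
  have i1 := (hu (intersection G ![true, false])).fun_add (hu (intersection G ![false, true]))
  have i2 := i1.fun_add (hl (intersection G ![false, false]))
  have i3 := i2.fun_add (hl (intersection G ![true, true]))
  refine ⟨(ha Finset.univ).fun_add i3, ?_⟩
  unfold totalDeviation
  rw [integral_add (ha _) i3, integral_add i2 (hl _), integral_add i1 (hl _),
    integral_add (hu _) (hu _)]
  linarith [ha' Finset.univ, hu' (intersection G ![true, false]),
    hu' (intersection G ![false, true]), hl' (intersection G ![false, false]),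
    hl' (intersection G ![true, true])]

/-- The utility loss of an optimal constrained selection is at least the smallest expected band
sum, up to the deviations from the mean. -/
lemma sub_totalDeviation_le_sub {m n : ℕ} (hm : 0 < m) {G : Fin 2 → Finset (Fin m)}
    {β : Fin 2 → ℝ} (hβ : ∀ ℓ, 0 < β ℓ) {L : Fin 2 → ℕ} {w : Fin m → ℝ}
    (hw : ∀ i, w i ∈ Set.Icc (0 : ℝ) 1) {S T : Finset (Fin m)}
    (hS : IsArgmax (constrainedSelections n G L) (observedUtility G β w) S)
    (hT : IsArgmax (selections m n) w T) {ρ t δ : ℝ}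
    (hρ : ∀ σ : Fin 2 → Bool, ρ * m ≤ (intersection G σ).card)
    (ht : t = 1 - n / m) (hδ : 0 ≤ δ) (hδt : δ ≤ t) (htδ : t + δ ≤ 1)
    (hδβ : δ * ((1 + β 0) * (1 + β 1)) ≤ t * ((1 - β 0) * (1 - β 1))) :
    ρ * m * (δ ^ 2 / 2) - totalDeviation G t δ w ≤ utility T w - utility S w := by
  have ht0 : 0 ≤ t := hδ.trans hδt
  have ht1 : t ≤ 1 := by linarith
  have h := sum_itemLoss_le_sub hw ⟨ht0, ht1⟩ hT hS.1.1
  have hN : deviation Finset.univ (aboveInd t) w = ∑ i, aboveInd t (w i) - n := by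
    have : (m : ℝ) ≠ 0 := by positivity
    rw [deviation, integral_aboveInd ⟨ht0, ht1⟩, ht, Finset.card_univ, Fintype.card_fin]
    field_simp
    ring
  have hup : ∀ σ, ρ * m * (δ ^ 2 / 2) - |deviation (intersection G σ) (upperBand t δ) w| ≤
      ∑ i ∈ intersection G σ, upperBand t δ (w i) := by
    intro σ
    have h1 := neg_abs_le (deviation (intersection G σ) (upperBand t δ) w)
    have h2 := mul_le_mul_of_nonneg_right (hρ σ) (by positivity : 0 ≤ δ ^ 2 / 2)
    nth_rewrite 2 [deviation] at h1
    rw [integral_upperBand ht0 hδ htδ] at h1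
    linarith
  have hlow : ∀ σ, ρ * m * (δ ^ 2 / 2) - |deviation (intersection G σ) (lowerBand t δ) w| ≤
      ∑ i ∈ intersection G σ, lowerBand t δ (w i) := by
    intro σ
    have h1 := neg_abs_le (deviation (intersection G σ) (lowerBand t δ) w)
    have h2 := mul_le_mul_of_nonneg_right (hρ σ) (by positivity : 0 ≤ δ ^ 2 / 2)
    nth_rewrite 2 [deviation] at h1
    rw [integral_lowerBand ht1 hδ hδt] at h1
    linarith
  have a1 := abs_nonneg (deviation (intersection G ![true, false]) (upperBand t δ) w)
  have a2 := abs_nonneg (deviation (intersection G ![false, true]) (upperBand t δ) w)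
  have a3 := abs_nonneg (deviation (intersection G ![false, false]) (lowerBand t δ) w)
  have a4 := abs_nonneg (deviation (intersection G ![true, true]) (lowerBand t δ) w)
  rw [totalDeviation, hN]
  rcases exists_band_le_sum_itemLoss hβ hS hδβ with h' | h' | h' | h'
  · linarith [hup ![true, false]]
  · linarith [hup ![false, true]]
  · linarith [hlow ![false, false]]
  · linarith [hlow ![true, true]]

lemma utility_nonneg {m : ℕ} {w : Fin m → ℝ} (hw : ∀ i, w i ∈ Set.Icc (0 : ℝ) 1)
    (S : Finset (Fin m)) : 0 ≤ utility S w :=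
  Finset.sum_nonneg fun i _ => (hw i).1

lemma utility_le_card {m : ℕ} {w : Fin m → ℝ} (hw : ∀ i, w i ∈ Set.Icc (0 : ℝ) 1)
    (S : Finset (Fin m)) : utility S w ≤ S.card :=
  (Finset.sum_le_sum fun i _ => (hw i).2).trans (by simp)

lemma div_le_one_sub_div {a b c x : ℝ} (ha : 0 ≤ a) (hab : a ≤ b) (hbc : b ≤ c)
    (hx : x ≤ b - a) : a / b ≤ 1 - x / c := by
  rcases (ha.trans hab).eq_or_lt with hb | hb
  · have hx0 : x ≤ 0 := by linarith
    have := div_nonpos_of_nonpos_of_nonneg hx0 (hb.le.trans hbc)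
    rw [← hb, div_zero]
    linarith
  · have h1 : a / b = 1 - (b - a) / b := by field_simp; ring
    have h2 : x / c ≤ (b - a) / c := div_le_div_of_nonneg_right hx (hb.le.trans hbc)
    have h3 : (b - a) / c ≤ (b - a) / b :=
      div_le_div_of_nonneg_left (sub_nonneg.2 hab) hb hbc
    linarith

lemma ratio_mem_Icc {m n p : ℕ} {G : Fin p → Finset (Fin m)} {β : Fin p → ℝ} {L : Fin p → ℕ}
    {xs xt : (Fin m → ℝ) → Finset (Fin m)} (hxs : IsLatentOptimal n xs)
    (hxt : IsConstrainedOptimal n G β L xt) {w : Fin m → ℝ}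
    (hw : ∀ i, w i ∈ Set.Icc (0 : ℝ) 1) : ratio xt xs w ∈ Set.Icc (0 : ℝ) 1 :=
  ⟨div_nonneg (utility_nonneg hw _) (utility_nonneg hw _),
    div_le_one_of_le₀ ((hxs w hw).2 _ (hxt w hw).1.1) (utility_nonneg hw _)⟩

lemma integrable_ratio {m n p : ℕ} {G : Fin p → Finset (Fin m)} {β : Fin p → ℝ}
    (hβ : ∀ ℓ, 0 < β ℓ) {L : Fin p → ℕ} {xs xt : (Fin m → ℝ) → Finset (Fin m)}
    (hxs : IsLatentOptimal n xs) (hxt : IsConstrainedOptimal n G β L xt) :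
    Integrable (ratio xt xs) (latentLaw m) := by
  have hs : AEMeasurable (fun w => utility (xs w) w) (latentLaw m) :=
    aemeasurable_utility_selector (c := 1) (fun _ => one_pos) (C := selections m n)
      fun w hw => by simpa using hxs w hw
  have ht : AEMeasurable (fun w => utility (xt w) w) (latentLaw m) :=
    aemeasurable_utility_selector (fun i => Finset.prod_pos fun ℓ _ => hβ ℓ) hxt
  refine Integrable.of_bound (ht.div hs).aestronglyMeasurable 1 ?_
  filter_upwards [ae_mem_Icc_latentLaw m] with w hw
  have h := ratio_mem_Icc hxs hxt hw
  exact (Real.norm_of_nonneg h.1).trans_le h.2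

/-- A bound with explicit error term: the utility ratio is at most `1 - ρ δ² / 2 + O(1 / √m)`
for every admissible band width `δ`. -/
lemma utilityRatio_le {m n : ℕ} (hm : 0 < m) (hn : 0 < n) {G : Fin 2 → Finset (Fin m)}
    {β : Fin 2 → ℝ} (hβ : ∀ ℓ, 0 < β ℓ) {L : Fin 2 → ℕ}
    {xs xt : (Fin m → ℝ) → Finset (Fin m)}
    (hxs : IsLatentOptimal n xs) (hxt : IsConstrainedOptimal n G β L xt) {ρ t δ : ℝ}
    (hρ : ∀ σ : Fin 2 → Bool, ρ * m ≤ (intersection G σ).card)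
    (ht : t = 1 - n / m) (hδ : 0 ≤ δ) (hδt : δ ≤ t) (htδ : t + δ ≤ 1)
    (hδβ : δ * ((1 + β 0) * (1 + β 1)) ≤ t * ((1 - β 0) * (1 - β 1))) :
    utilityRatio xt xs ≤ 1 - (ρ * m * (δ ^ 2 / 2) - 5 * √m) / n := by
  obtain ⟨hD, hD'⟩ := integral_totalDeviation_le hm G t (by linarith : δ ≤ 1)
  have hE : Integrable (fun w => (ρ * m * (δ ^ 2 / 2) - totalDeviation G t δ w) / n)
      (latentLaw m) := ((integrable_const _).sub hD).div_const _
  have hI : Integrable (fun w => 1 - (ρ * m * (δ ^ 2 / 2) - totalDeviation G t δ w) / n)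
      (latentLaw m) := (integrable_const _).sub hE
  calc utilityRatio xt xs
      ≤ ∫ w, (1 - (ρ * m * (δ ^ 2 / 2) - totalDeviation G t δ w) / n) ∂latentLaw m := by
        refine integral_mono_ae (integrable_ratio hβ hxs hxt) hI ?_
        filter_upwards [ae_mem_Icc_latentLaw m] with w hw
        refine div_le_one_sub_div (utility_nonneg hw _) ((hxs w hw).2 _ (hxt w hw).1.1) ?_
          (sub_totalDeviation_le_sub hm hβ hw (hxt w hw) (hxs w hw) hρ ht hδ hδt htδ hδβ)
        exact (utility_le_card hw _).trans_eq (congrArg Nat.cast (hxs w hw).1)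
    _ = 1 - (ρ * m * (δ ^ 2 / 2) - ∫ w, totalDeviation G t δ w ∂latentLaw m) / n := by
        rw [integral_sub (integrable_const _) hE, integral_div,
          integral_sub (integrable_const _) hD]
        simp
    _ ≤ 1 - (ρ * m * (δ ^ 2 / 2) - 5 * √m) / n := by
        gcongr

theorem mainTheorem1 (η ρ : ℝ) (hη : 0 < η) (hρ : 0 < ρ)
    (β : Fin 2 → ℝ) (hβ : ∀ ℓ, 0 < β ℓ ∧ β ℓ ≤ 1) :
    ∃ m₀ : ℕ, ∀ m : ℕ, m₀ ≤ m → ∀ n : ℕ,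
      η < (n : ℝ) / (m : ℝ) → (n : ℝ) / (m : ℝ) < 1 - η →
      ∀ G : Fin 2 → Finset (Fin m),
        (∀ σ : Fin 2 → Bool,
          ρ * (m : ℝ) ≤ ((intersection G σ).card : ℝ) ∧
          ((intersection G σ).card : ℝ) ≤ (1 - ρ) * (m : ℝ)) →
        ∀ L : Fin 2 → ℕ, ∀ xs xt : (Fin m → ℝ) → Finset (Fin m),
          IsLatentOptimal n xs → IsConstrainedOptimal n G β L xt →
          MeasureTheory.Integrable (ratio xt xs) (latentLaw m) ∧
          utilityRatio xt xs ≤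
            1 - (ρ / 3 * min η (1 - η) * (1 - β 0) * (1 - β 1)) ^ 2 := by
  obtain ⟨hb0, hb0'⟩ := hβ 0
  obtain ⟨hb1, hb1'⟩ := hβ 1
  have hβ' : ∀ ℓ, 0 < β ℓ := fun ℓ => (hβ ℓ).1
  set B := (1 - β 0) * (1 - β 1) with hB
  have hB0 : 0 ≤ B := mul_nonneg (by linarith) (by linarith)
  rcases hB0.eq_or_lt with hBz | hBpos
  · -- If one of the groups is unbiased, the claim is that the ratio is at most one.
    refine ⟨0, fun m _ n _ _ G _ L xs xt hxs hxt => ⟨integrable_ratio hβ' hxs hxt, ?_⟩⟩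
    have hz : (ρ / 3 * min η (1 - η) * (1 - β 0) * (1 - β 1)) ^ 2 = 0 := by
      rw [mul_assoc (ρ / 3 * _), ← hB, ← hBz]; simp
    rw [hz, sub_zero]
    refine (integral_mono_ae (integrable_ratio hβ' hxs hxt) (integrable_const 1) ?_).trans
      (by simp)
    filter_upwards [ae_mem_Icc_latentLaw m] with w hw
    exact (ratio_mem_Icc hxs hxt hw).2
  · -- With `δ = η B / 4`, the gain `ρ δ² / 2 = ρ η² B² / 32` exceeds the claimed
    -- `ρ² η² B² / 9 ≤ ρ η² B² / 36` by `ε`, which absorbs the error `5 / (η √m)`.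
    set ε := ρ * η ^ 2 * B ^ 2 / 288 with hε
    have hεpos : 0 < ε := by positivity
    obtain ⟨m₀, hm₀⟩ := exists_nat_gt ((5 / (η * ε)) ^ 2)
    refine ⟨m₀, fun m hm n hn1 hn2 G hG L xs xt hxs hxt =>
      ⟨integrable_ratio hβ' hxs hxt, ?_⟩⟩
    have hmR : (5 / (η * ε)) ^ 2 < (m : ℝ) := hm₀.trans_le (by exact_mod_cast hm)
    have hmpos : (0 : ℝ) < m := (sq_nonneg _).trans_lt hmR
    have hm1 : 0 < m := by exact_mod_cast hmpos
    have hn1' : η * m < n := (lt_div_iff₀ hmpos).1 hn1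
    have hnR : (0 : ℝ) < n := (by positivity : 0 < η * m).trans hn1'
    have hn : 0 < n := by exact_mod_cast hnR
    have hnm : (n : ℝ) ≤ m := ((div_lt_one hmpos).1 (by linarith)).le
    have hsqrt : 5 / (η * ε) < √m := Real.lt_sqrt_of_sq_lt hmR
    have herr : 5 * √m ≤ ε * n := by
      have h1 : 5 < √m * (η * ε) := (div_lt_iff₀ (by positivity)).1 hsqrt
      have h2 : √(m : ℝ) * √m = m := Real.mul_self_sqrt hmpos.le
      calc 5 * √m ≤ √m * (η * ε) * √m := by gcongr
        _ = ε * (η * (√m * √m)) := by ring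
        _ = ε * (η * m) := by rw [h2]
        _ ≤ ε * n := by gcongr
    have hρ4 : 4 * ρ ≤ 1 := by
      have h1 : ((∑ σ : Fin 2 → Bool, (intersection G σ).card : ℕ) : ℝ) = m := by
        rw [sum_card_intersection]
      have h2 : ∑ _σ : Fin 2 → Bool, ρ * (m : ℝ) ≤ m := by
        refine le_of_le_of_eq ?_ h1
        rw [Nat.cast_sum]
        exact Finset.sum_le_sum fun σ _ => (hG σ).1
      simp only [Finset.sum_const, Finset.card_univ, Fintype.card_fun, Fintype.card_bool,
        Fintype.card_fin, nsmul_eq_mul] at h2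
      push_cast at h2
      exact le_of_mul_le_mul_right (by linarith) hmpos
    have hB1 : B ≤ 1 := by
      rw [hB]
      exact mul_le_one₀ (by linarith) (by linarith) (by linarith)
    have hδη : η * B / 4 ≤ η := by nlinarith
    have hmain := utilityRatio_le hm1 hn hβ' hxs hxt (fun σ => (hG σ).1) rfl
      (δ := η * B / 4) (by positivity) (by linarith) (by linarith) (by
        have h1 : (1 + β 0) * (1 + β 1) ≤ 2 * 2 := by gcongr <;> linarith
        calc η * B / 4 * ((1 + β 0) * (1 + β 1)) ≤ η * B / 4 * (2 * 2) := by gcongr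
          _ = η * B := by ring
          _ ≤ _ := by gcongr; linarith)
    refine hmain.trans (sub_le_sub_left ?_ 1)
    rw [min_eq_left (by linarith), mul_assoc (ρ / 3 * _), ← hB, le_div_iff₀ hnR]
    have h1 : (ρ / 3 * η * B) ^ 2 ≤ 8 * ε := by
      have : (ρ / 3 * η * B) ^ 2 = (4 * ρ) * (8 * ε) := by rw [hε]; ring
      rw [this]
      exact mul_le_of_le_one_left (by positivity) hρ4
    have h2 : ρ * m * ((η * B / 4) ^ 2 / 2) = 9 * ε * m := by rw [hε]; ring
    rw [h2]
    calc (ρ / 3 * η * B) ^ 2 * n ≤ 8 * ε * n := by gcongr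
      _ = 9 * ε * n - ε * n := by ring
      _ ≤ 9 * ε * m - 5 * √m := by gcongr
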